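/- Let $\mathbb{S}$ be the Sierpinski space, with points $0,1$ and open sets $\emptyset,\{1\},\{0,1\}$, and let $2=\{0<1\}$ be the two-element frame. Let $\mathbf{Frm}$ be the category of frames and maps preserving finite meets and arbitrary joins. Let $\mathcal{L}$ be the free frame monad on $\mathbf{Set}$; it sends $X$ to the set $\mathcal{L}X$ of upwards closed families of finite subsets of $X$, and $x\in X$ is identified with the generator $\{F : x\in F\}\in\mathcal{L}X$. Let $I_{\mathcal{L}}\colon\mathbf{Kl}(\mathcal{L})\to\mathbf{Frm}$ be the canonical embedding of its Kleisli category, sending a set to its free frame. Let $J\colon\mathbf{Sier}\hookrightarrow\mathbf{Top}$ be the full subcategory on the powers $\mathbb{S}^X$, $X$ any set. Let $\mathcal{S}$ be the sobrification monad on $\mathbf{Top}$, $\mathcal{S}X=\mathbf{Frm}(\mathbf{Top}(X,\mathbb{S}),2)$, that is, the monad induced by the dual adjunction $\mathbf{Top}(-,\mathbb{S})\dashv\mathbf{Frm}(-,2)\colon\mathbf{Frm}^{\mathrm{op}}\to\mathbf{Top}$ whose unit and counit are given by evaluation. Here $\mathbf{Top}(X,\mathbb{S})$ is ordered pointwise,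 and $\mathbf{Frm}(A,2)$ is a subspace of the product space $\mathbb{S}^{A}$. 1. The functor $E\colon\mathbf{Kl}(\mathcal{L})^{\mathrm{op}}\to\mathbf{Sier}$ that sends a set $X$ to $\mathbb{S}^X$ and a Kleisli morphism $f\colon X\to\mathcal{L}Y$ to the continuous map $\mathbb{S}^Y\to\mathbb{S}^X$, $p\mapsto\hat p\circ f$, where $\hat p\colon\mathcal{L}Y\to 2$ is the unique frame homomorphism extending $p\colon Y\to 2$, is an equivalence of categories. 2. Restriction of frame homomorphisms to generators defines homeomorphisms $\mathbf{Frm}(\mathcal{L}X,2)\cong\mathbb{S}^X$ that form a natural isomorphism $J\circ E\cong\mathbf{Frm}(-,2)\circ I_{\mathcal{L}}^{\mathrm{op}}$. 3. The codensity monad of $J$ exists, its underlying right Kan extension of $J$ along $J$ is pointwise (that is, for every space $X$ the canonical limit $\lim_{X\to JA}JA$ exists), and it is isomorphic, as a monad on $\mathbf{Top}$, to the sobrification monad $\mathcal{S}$. -/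

import Mathlib

open CategoryTheory OrderDual

universe u v w v₁ u₁ v₂ u₂

/-! ### Codensity monads -/

section Codensity

variable {A : Type u₁} [Category.{v₁} A] {C : Type u₂} [Category.{v₂} C]
variable (F : A ⥤ C) [F.HasRightKanExtension F]

/-- The unit of the codensity monad: the transformation `𝟭 ⟶ Ran_F F` that corresponds to the
identity `F ⟶ F`. -/
noncomputable def codensityUnit : 𝟭 C ⟶ F.rightKanExtension F :=
  (F.rightKanExtension F).liftOfIsRightKanExtension (F.rightKanExtensionCounit F) (𝟭 C)
    F.rightUnitor.hom

/-- The multiplication of the codensity monad: the transformation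
`Ran_F F ∘ Ran_F F ⟶ Ran_F F` that corresponds to `φ ∘ (Ran_F F) φ`, where `φ` is the counit of the
right Kan extension. -/
noncomputable def codensityMult :
    F.rightKanExtension F ⋙ F.rightKanExtension F ⟶ F.rightKanExtension F :=
  (F.rightKanExtension F).liftOfIsRightKanExtension (F.rightKanExtensionCounit F) _
    ((Functor.associator _ _ _).inv ≫
      Functor.whiskerRight (F.rightKanExtensionCounit F) (F.rightKanExtension F) ≫
      F.rightKanExtensionCounit F)

theorem codensityUnit_counit (a : A) :
    (codensityUnit F).app (F.obj a) ≫ (F.rightKanExtensionCounit F).app a = 𝟙 (F.obj a) := by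
  simp [codensityUnit]

theorem codensityMult_counit (a : A) :
    (codensityMult F).app (F.obj a) ≫ (F.rightKanExtensionCounit F).app a =
      (F.rightKanExtension F).map ((F.rightKanExtensionCounit F).app a) ≫
        (F.rightKanExtensionCounit F).app a := by
  simp [codensityMult]

/-- The codensity monad of a functor `F`, carried by the right Kan extension of `F` along
itself. -/
noncomputable def codensityMonad : Monad C where
  toFunctor := F.rightKanExtension F
  η := codensityUnit F
  μ := codensityMult F
  assoc X := by
    let T := F.rightKanExtension F
    let l : (T ⋙ T) ⋙ T ⟶ T := Functor.whiskerRight (codensityMult F) T ≫ codensityMult F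
    let r : (T ⋙ T) ⋙ T ⟶ T := Functor.whiskerLeft T (codensityMult F) ≫ codensityMult F
    have h : l = r := by
      apply T.hom_ext_of_isRightKanExtension (F.rightKanExtensionCounit F)
      ext a
      simp only [l, r, T, Functor.whiskerLeft_app, NatTrans.comp_app, Functor.whiskerRight_app,
        Category.assoc, codensityMult_counit, Functor.comp_obj]
      rw [← NatTrans.naturality_assoc, codensityMult_counit, ← Functor.map_comp_assoc,
        codensityMult_counit, Functor.comp_map, ← Functor.map_comp_assoc]
    exact congr_app h X
  left_unit X := by
    let T := F.rightKanExtension F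
    let l : T ⟶ T := Functor.whiskerLeft T (codensityUnit F) ≫ codensityMult F
    have h : l = 𝟙 T := by
      apply T.hom_ext_of_isRightKanExtension (F.rightKanExtensionCounit F)
      ext a
      simp only [l, T, Functor.whiskerLeft_app, NatTrans.comp_app,
        Category.assoc, codensityMult_counit, NatTrans.id_app]
      rw [← NatTrans.naturality_assoc, codensityUnit_counit]
      simp
    exact congr_app h X
  right_unit X := by
    let T := F.rightKanExtension F
    let l : T ⟶ T := Functor.whiskerRight (codensityUnit F) T ≫ codensityMult F
    have h : l = 𝟙 T := by
      apply T.hom_ext_of_isRightKanExtension (F.rightKanExtensionCounit F)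
      ext a
      simp only [l, T, Functor.whiskerLeft_app, NatTrans.comp_app, Functor.whiskerRight_app,
        Category.assoc, codensityMult_counit, NatTrans.id_app]
      rw [← Functor.map_comp_assoc, codensityUnit_counit]
      simp
    exact congr_app h X

end Codensity

/-! ### The free frame monad -/

/-- The free frame on `X`: upwards closed subsets of the poset of finite subsets of `X`, ordered by
inclusion. -/
abbrev FreeFrame (X : Type u) : Type u := LowerSet (Finset X)ᵒᵈ

namespace FreeFrame

/-- The insertion of generators: `x` is sent to the set of all finite subsets that contain `x`. -/
def gen {X : Type u} (x : X) : FreeFrame X where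
  carrier := {F | x ∈ ofDual F}
  lower' _ _ h hF := h hF

/-- The frame homomorphism `U ↦ ⋁_{F ∈ U} ⋀_{x ∈ F} f x` that extends a map `f` from `X` to a
frame. -/
def lift {X : Type u} {A : Type v} [Order.Frame A] (f : X → A) : FrameHom (FreeFrame X) A where
  toFun U := ⨆ (F : Finset X) (_ : toDual F ∈ U), F.inf f
  map_inf' U V := by
    classical
    apply le_antisymm
    · refine iSup₂_le fun F hF => le_inf ?_ ?_
      · exact le_iSup₂_of_le F hF.1 le_rfl
      · exact le_iSup₂_of_le F hF.2 le_rfl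
    · rw [iSup₂_inf_eq]
      refine iSup₂_le fun F hF => ?_
      rw [inf_iSup₂_eq]
      refine iSup₂_le fun G hG => ?_
      refine le_iSup₂_of_le (F ∪ G) ⟨?_, ?_⟩ ?_
      · exact U.lower (toDual_le_toDual.2 Finset.subset_union_left) hF
      · exact V.lower (toDual_le_toDual.2 Finset.subset_union_right) hG
      · rw [Finset.inf_union]
  map_top' := top_le_iff.1 (le_iSup₂_of_le ∅ trivial (by simp))
  map_sSup' S := by
    apply le_antisymm
    · refine iSup₂_le fun F hF => ?_
      obtain ⟨U, hU, hFU⟩ := LowerSet.mem_sSup_iff.1 hF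
      exact le_sSup_of_le ⟨U, hU, rfl⟩ (le_iSup₂_of_le F hFU le_rfl)
    · refine sSup_le ?_
      rintro _ ⟨U, hU, rfl⟩
      exact iSup₂_le fun F hF =>
        le_iSup₂_of_le F (LowerSet.mem_sSup_iff.2 ⟨U, hU, hF⟩) le_rfl

theorem lift_gen {X : Type u} {A : Type v} [Order.Frame A] (f : X → A) (x : X) :
    lift f (gen x) = f x := by
  apply le_antisymm
  · exact iSup₂_le fun F hF => Finset.inf_le hF
  · exact le_iSup₂_of_le {x} (Finset.mem_singleton_self x) (by simp)

theorem eq_iSup {X : Type u} (U : FreeFrame X) :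
    U = ⨆ (F : Finset X) (_ : toDual F ∈ U), F.inf gen := by
  have key : ∀ F G : Finset X, toDual G ∈ F.inf (gen (X := X)) ↔ F ⊆ G := by
    classical
    intro F G
    induction F using Finset.induction_on with
    | empty => simp
    | insert a s _ ih =>
      rw [Finset.inf_insert, LowerSet.mem_inf_iff, ih, Finset.insert_subset_iff]
      rfl
  ext G
  change toDual (ofDual G) ∈ U ↔ _
  simp only [SetLike.mem_coe, LowerSet.mem_iSup_iff]
  constructor
  · intro h
    exact ⟨ofDual G, h, (key _ _).2 subset_rfl⟩
  · rintro ⟨F, hF, hG⟩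
    exact U.lower (toDual_le_toDual.2 ((key F (ofDual G)).1 hG)) hF

theorem hom_ext {X : Type u} {A : Type v} [Order.Frame A] {g h : FrameHom (FreeFrame X) A}
    (H : ∀ x, g (gen x) = h (gen x)) : g = h := by
  ext U
  rw [eq_iSup U]
  simp only [map_iSup, map_finset_inf]
  have : (g ∘ gen : X → A) = h ∘ gen := funext H
  rw [this]

theorem hom_lift {X : Type u} {A : Type v} {B : Type w} [Order.Frame A] [Order.Frame B]
    (g : FrameHom A B) (f : X → A) : g.comp (lift f) = lift fun x => g (f x) :=
  hom_ext fun x => by simp [lift_gen]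

/-- The universal property of the free frame. -/
def homEquiv (X : Type u) (A : Frm.{u}) :
    (Frm.of (FreeFrame X) ⟶ A) ≃ (X ⟶ (forget Frm.{u}).obj A) where
  toFun g := TypeCat.ofHom fun x => g.hom (gen x)
  invFun f := Frm.ofHom (lift fun x => (f x : A))
  left_inv g := by
    apply Frm.hom_ext
    exact hom_ext fun x => lift_gen _ x
  right_inv f := by
    ext x
    exact lift_gen _ x

end FreeFrame

/-- The free frame functor. -/
def freeFrame : Type u ⥤ Frm.{u} :=
  Adjunction.leftAdjointOfEquiv (G := forget Frm.{u}) FreeFrame.homEquiv fun _ _ _ _ _ => rfl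

/-- The free frame functor is left adjoint to the forgetful functor. -/
def freeFrameAdjunction : freeFrame.{u} ⊣ forget Frm.{u} :=
  Adjunction.adjunctionOfEquivLeft FreeFrame.homEquiv fun _ _ _ _ _ => rfl

/-- The free frame monad on the category of sets. -/
def freeFrameMonad : Monad (Type u) := freeFrameAdjunction.toMonad

/-- The map from `X` to the free frame on `Y` that underlies a Kleisli morphism. -/
def kleisliFun {X Y : Kleisli freeFrameMonad.{u}} (f : X ⟶ Y) (x : X.of) : FreeFrame Y.of :=
  f.of x

/-- The extension of a map `f : X → L Y` to a frame homomorphism `L X → L Y`. -/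
def kleisliExtend {X Y : Kleisli freeFrameMonad.{u}} (f : X ⟶ Y) :
    FrameHom (FreeFrame X.of) (FreeFrame Y.of) :=
  FreeFrame.lift (kleisliFun f)

theorem kleisliExtend_id (X : Kleisli freeFrameMonad.{u}) :
    kleisliExtend (𝟙 X) = FrameHom.id _ :=
  FreeFrame.hom_ext fun x => FreeFrame.lift_gen _ x

theorem kleisli_comp_apply {X Y Z : Kleisli freeFrameMonad.{u}} (f : X ⟶ Y) (g : Y ⟶ Z)
    (x : X.of) : kleisliFun (f ≫ g) x = kleisliExtend g (kleisliFun f x) := by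
  have h : FrameHom.comp
      (FreeFrame.lift (fun W : FreeFrame Z.of => W) : FrameHom (FreeFrame (FreeFrame Z.of)) _)
      (FreeFrame.lift fun y => FreeFrame.gen (kleisliFun g y)) = kleisliExtend g := by
    rw [FreeFrame.hom_lift]
    exact congrArg FreeFrame.lift (funext fun y => FreeFrame.lift_gen _ _)
  rw [← h]
  rfl

theorem kleisliExtend_comp {X Y Z : Kleisli freeFrameMonad.{u}} (f : X ⟶ Y) (g : Y ⟶ Z) :
    kleisliExtend (f ≫ g) = (kleisliExtend g).comp (kleisliExtend f) := by
  refine Eq.trans ?_ (FreeFrame.hom_lift _ _).symm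
  exact congrArg FreeFrame.lift (funext fun x => kleisli_comp_apply f g x)

/-- The embedding of the Kleisli category of the free frame monad into the category of frames as
the full subcategory of free frames. -/
def kleisliToFrm : Kleisli freeFrameMonad.{u} ⥤ Frm.{u} where
  obj X := Frm.of (FreeFrame X.of)
  map f := Frm.ofHom (kleisliExtend f)
  map_id X := by rw [kleisliExtend_id]; rfl
  map_comp f g := by rw [kleisliExtend_comp]; rfl

/-! ### The sobrification monad

The type `Prop` carries the Sierpinski topology, whose open sets are `∅`, `{True}` and the whole
space, and it is the two-element frame `2`. -/

section SierpinskiFrame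

variable (X : Type u) [TopologicalSpace X]

/-- The continuous maps from `X` to the Sierpinski space form a complete lattice under the pointwise
order. Finite meets and arbitrary joins are computed pointwise. -/
noncomputable instance sierpinskiCompleteLattice : CompleteLattice C(X, Prop) where
  __ := (inferInstance : SemilatticeSup C(X, Prop))
  __ := completeLatticeOfSup (α := C(X, Prop))
    (H2 := ⟨fun S => ⟨fun x => ∃ f ∈ S, f x, continuous_Prop.2 (by
      have : {x | ∃ f ∈ S, f x} = ⋃ f ∈ S, {x | f x} := by ext; simp
      rw [this]
      exact isOpen_biUnion fun f _ => continuous_Prop.1 f.continuous)⟩⟩)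
    (fun S => ⟨fun f hf x hx => ⟨f, hf, hx⟩, fun g hg x hx => by
      obtain ⟨f, hf, hfx⟩ := hx
      exact hg hf x hfx⟩)
  inf f g := ⟨fun x => f x ∧ g x, continuous_Prop.2
    ((continuous_Prop.1 f.continuous).inter (continuous_Prop.1 g.continuous))⟩
  inf_le_left _ _ _ h := h.1
  inf_le_right _ _ _ h := h.2
  le_inf _ _ _ h₁ h₂ x h := ⟨h₁ x h, h₂ x h⟩
  top := ⟨fun _ => True, continuous_const⟩
  le_top _ _ _ := trivial

variable {X}

theorem sierpinski_inf_apply (f g : C(X, Prop)) (x : X) : (f ⊓ g) x ↔ f x ∧ g x := Iff.rfl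

theorem sierpinski_sSup_apply (S : Set C(X, Prop)) (x : X) : (sSup S) x ↔ ∃ f ∈ S, f x := Iff.rfl

variable (X)

/-- The frame of continuous maps from `X` to the Sierpinski space. -/
noncomputable instance sierpinskiFrame : Order.Frame C(X, Prop) :=
  Order.Frame.ofMinimalAxioms
    { inf_sSup_le_iSup_inf := fun f S x hx => by
        obtain ⟨hf, g, hg, hgx⟩ := hx
        exact (le_iSup₂_of_le (f := fun b (_ : b ∈ S) => f ⊓ b) g hg le_rfl) x ⟨hf, hgx⟩ }

end SierpinskiFrame

/-- Precomposition with a continuous map, as a frame homomorphism. -/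
def sierpinskiPrecomp {X Y : Type u} [TopologicalSpace X] [TopologicalSpace Y] (f : C(X, Y)) :
    FrameHom C(Y, Prop) C(X, Prop) where
  toFun g := g.comp f
  map_inf' _ _ := rfl
  map_top' := rfl
  map_sSup' S := by
    ext x
    rw [sierpinski_sSup_apply]
    simp only [Set.exists_mem_image]
    rfl

/-- The functor `Top(-, 𝕊)` from topological spaces to the opposite category of frames. -/
noncomputable def sierpinskiHom : TopCat.{u} ⥤ Frm.{u}ᵒᵖ where
  obj X := Opposite.op (Frm.of C(X, Prop))
  map f := (Frm.ofHom (sierpinskiPrecomp f.hom)).op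

theorem framePoints_continuous_eval (A : Type u) [Order.Frame A] (a : A) :
    Continuous fun p : FrameHom A Prop => p a :=
  continuous_Prop.2 ⟨a, rfl⟩

/-- The topology of the space of points `Frm(A, 2)` is that of a subspace of the product space
`𝕊 ^ A`. -/
theorem framePoints_topology (A : Type u) [Order.Frame A] :
    (inferInstance : TopologicalSpace (FrameHom A Prop)) =
      TopologicalSpace.induced (fun p (a : A) => p a) Pi.topologicalSpace := by
  apply le_antisymm
  · exact (continuous_pi fun a => framePoints_continuous_eval A a).le_induced
  · rintro _ ⟨a, rfl⟩
    exact ⟨{q | q a}, continuous_Prop.1 (continuous_apply a), rfl⟩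

theorem framePoints_continuous_iff {X : Type v} [TopologicalSpace X] {A : Type u} [Order.Frame A]
    {f : X → FrameHom A Prop} : Continuous f ↔ ∀ a, Continuous fun x => f x a := by
  have h : Topology.IsInducing fun (p : FrameHom A Prop) (a : A) => p a :=
    ⟨framePoints_topology A⟩
  rw [h.continuous_iff]
  exact continuous_pi_iff

/-- The functor `Frm(-, 2)` from the opposite category of frames to topological spaces. -/
abbrev framePoints : Frm.{u}ᵒᵖ ⥤ TopCat.{u} := Locale.pt.{u}

/-- Evaluation of continuous maps to the Sierpinski space at a point. -/
def sierpinskiEval {X : Type u} [TopologicalSpace X] (x : X) : FrameHom C(X, Prop) Prop where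
  toFun f := f x
  map_inf' _ _ := rfl
  map_top' := rfl
  map_sSup' S := by
    apply propext
    rw [sierpinski_sSup_apply, sSup_Prop_eq]
    constructor
    · rintro ⟨f, hf, hx⟩
      exact ⟨_, ⟨f, hf, rfl⟩, hx⟩
    · rintro ⟨_, ⟨f, hf, rfl⟩, hx⟩
      exact ⟨f, hf, hx⟩

/-- Evaluation of frame homomorphisms to `2` at an element. -/
def framePointsEval (A : Type u) [Order.Frame A] : FrameHom A C(FrameHom A Prop, Prop) where
  toFun a := ⟨fun p => p a, framePoints_continuous_eval A a⟩
  map_inf' a b := ContinuousMap.ext fun p => map_inf p a b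
  map_top' := ContinuousMap.ext fun p => map_top p
  map_sSup' S := by
    ext p
    rw [sierpinski_sSup_apply]
    simp only [ContinuousMap.coe_mk, map_sSup, sSup_Prop_eq, Set.exists_mem_image]

/-- The dual adjunction between `Top(-, 𝕊)` and `Frm(-, 2)`; the unit and the counit are given by
evaluation. -/
noncomputable def sobrificationAdjunction : sierpinskiHom.{u} ⊣ framePoints.{u} where
  unit :=
    { app X := TopCat.ofHom ⟨sierpinskiEval,
        framePoints_continuous_iff.2 fun f : C(X, Prop) => f.continuous⟩ }
  counit := { app A := Quiver.Hom.op (Frm.ofHom (framePointsEval A.unop)) }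

/-- The sobrification monad on the category of topological spaces. -/
noncomputable def sobrificationMonad : Monad TopCat.{u} := sobrificationAdjunction.toMonad

/-! ### Powers of the Sierpinski space -/

/-- The topological spaces `𝕊 ^ X`, for all sets `X`, with the product topology. -/
def sierpinskiPowers : ObjectProperty TopCat.{u} :=
  ObjectProperty.ofObj fun X : Type u => TopCat.of (X → Prop)

/-- The full subcategory of the category of topological spaces on the powers of the Sierpinski
space. -/
abbrev Sier : Type (u + 1) := sierpinskiPowers.{u}.FullSubcategory

/-- The inclusion functor of `Sier` into topological spaces. -/
abbrev sierInclusion : Sier.{u} ⥤ TopCat.{u} := sierpinskiPowers.{u}.ι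

theorem continuous_lift_apply {X : Type u} (U : FreeFrame X) :
    Continuous fun p : X → Prop => FreeFrame.lift p U := by
  have h : ∀ F : Finset X, IsOpen {p : X → Prop | F.inf p} := by
    classical
    intro F
    induction F using Finset.induction_on with
    | empty => simp
    | insert a s _ ih =>
      simp only [Finset.inf_insert]
      exact (continuous_Prop.1 (continuous_apply a)).inter ih
  have : {p : X → Prop | FreeFrame.lift p U} =
      ⋃ (F : Finset X) (_ : toDual F ∈ U), {p : X → Prop | F.inf p} := by
    ext p
    change (⨆ (F : Finset X) (_ : toDual F ∈ U), F.inf p) ↔ _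
    simp
  rw [continuous_Prop, this]
  exact isOpen_iUnion fun F => isOpen_iUnion fun _ => h F

/-- The functor `X ↦ 𝕊 ^ X` from the opposite of the Kleisli category of the free frame monad to
`Sier`. A Kleisli morphism `f : X → L Y` is sent to the continuous map `𝕊 ^ Y → 𝕊 ^ X` that takes
`p : Y → 2` to the composite of `f` with the frame homomorphism `L Y → 2` extending `p`; in other
words, `x` is sent to true if and only if some finite set in `f x` is contained in `p`. -/
def sierpinskiPower : (Kleisli freeFrameMonad.{u})ᵒᵖ ⥤ Sier.{u} where
  obj X := ⟨TopCat.of (X.unop.of → Prop), ⟨X.unop.of⟩⟩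
  map {Y X} f := ObjectProperty.homMk (TopCat.ofHom
    ⟨fun (p : Y.unop.of → Prop) (x : X.unop.of) =>
      FreeFrame.lift p (kleisliFun f.unop x),
      continuous_pi fun _ => continuous_lift_apply _⟩)
  map_id X := by
    ext p x
    exact iff_of_eq (FreeFrame.lift_gen p x)
  map_comp {Z Y X} f g := by
    ext p x
    change FreeFrame.lift p (kleisliFun (g.unop ≫ f.unop) x) ↔
      FreeFrame.lift (fun y => FreeFrame.lift p (kleisliFun f.unop y)) (kleisliFun g.unop x)
    rw [kleisli_comp_apply, ← FreeFrame.hom_lift]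
    rfl

/-! ### Isomorphism with the codensity monad -/

section Codensity

variable {A : Type u₁} [Category.{v₁} A] {C : Type u₂} [Category.{v₂} C]
variable (F : A ⥤ C) (T : Monad C)

/-! An open subset of `𝕊 ^ X` is an upper set generated by finite subsets of `X`, so continuous maps
`𝕊 ^ X → 𝕊` are the elements of the free frame on `X` (`exists_lift_eq`,
`FreeFrame.lift_apply_injective`). Taken coordinatewise, this gives the equivalence; the points of a
free frame come from its universal property.

For codensity, `C(𝕊 ^ Y, 𝕊)` is generated by the projections, so the sobrification unit is
invertible on powers of `𝕊`, and by `nonempty_iso_codensityMonad` only the Kan extension property is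
needed. A point of a cone over the maps `X → 𝕊 ^ Y` assigns a truth value to each `f : X → 𝕊`,
compatibly with all continuous maps `𝕊 ^ Y → 𝕊`. Finite meets and arbitrary joins are such maps, so
the assignment is a frame homomorphism, that is, a point of the sobrification (`legPoint`). -/

/-- If the unit of a monad is invertible on the image of `F`, then its inverse exhibits the monad
as an extension of `F` along `F`. -/
noncomputable def unitInvExtension [∀ a, IsIso (T.η.app (F.obj a))] :
    F.RightExtension F :=
  Functor.RightExtension.mk T.toFunctor
    { app a := inv (T.η.app (F.obj a))
      naturality a b f := by
        rw [IsIso.comp_inv_eq, Category.assoc, IsIso.eq_inv_comp]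
        exact (T.η.naturality (F.map f)).symm }

/-- Moving the inverse unit across the equation lets cone factorisations be checked using the unit
alone. -/
theorem comp_unitInvExtension_coneAt_π_eq_iff [∀ a, IsIso (T.η.app (F.obj a))] {X W : C}
    (a : StructuredArrow X F) (m : W ⟶ T.obj X) (k : W ⟶ F.obj a.right) :
    m ≫ ((unitInvExtension F T).coneAt X).π.app a = k ↔
      m ≫ T.map a.hom = k ≫ T.η.app (F.obj a.right) := by
  rw [← IsIso.comp_inv_eq, Category.assoc]
  rfl

/-- A monad whose functor is a right Kan extension of `F` along `F`, with counit the inverse of the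
unit of the monad, is the codensity monad of `F`. -/
theorem nonempty_iso_codensityMonad [∀ a, IsIso (T.η.app (F.obj a))]
    [F.HasRightKanExtension F]
    (h : T.toFunctor.IsRightKanExtension (unitInvExtension F T).hom) :
    Nonempty (T ≅ codensityMonad F) := by
  let R := F.rightKanExtension F
  let c := F.rightKanExtensionCounit F
  let e : T.toFunctor ≅ R :=
    T.toFunctor.rightKanExtensionUnique (unitInvExtension F T).hom R c
  have he (a : A) : e.hom.app (F.obj a) ≫ c.app a = inv (T.η.app (F.obj a)) :=
    (congrArg (fun k : T.toFunctor ⟶ R => k.app (F.obj a) ≫ c.app a)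
      (show e.hom = R.liftOfIsRightKanExtension c T.toFunctor (unitInvExtension F T).hom from
        congrArg (R.liftOfIsRightKanExtension c T.toFunctor) (Category.comp_id _))).trans
      (R.liftOfIsRightKanExtension_fac_app c T.toFunctor (unitInvExtension F T).hom a)
  have hη : T.η ≫ e.hom = codensityUnit F := by
    -- Transformations into the Kan extension are determined by their composites with the counit, so
    -- only objects `F a` matter.
    apply R.hom_ext_of_isRightKanExtension c
    ext a
    change (T.η.app (F.obj a) ≫ e.hom.app (F.obj a)) ≫ c.app a =
      (codensityUnit F).app (F.obj a) ≫ c.app a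
    rw [codensityUnit_counit, Category.assoc, he, IsIso.hom_inv_id]
    rfl
  have hμ : T.μ ≫ e.hom = (Functor.whiskerRight e.hom T.toFunctor ≫
      Functor.whiskerLeft R e.hom) ≫ codensityMult F := by
    apply R.hom_ext_of_isRightKanExtension c
    ext a
    change (T.μ.app (F.obj a) ≫ e.hom.app (F.obj a)) ≫ c.app a =
      ((T.map (e.hom.app (F.obj a)) ≫ e.hom.app (R.obj (F.obj a))) ≫
        (codensityMult F).app (F.obj a)) ≫ c.app a
    rw [Category.assoc, Category.assoc, codensityMult_counit, Category.assoc,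
      ← e.hom.naturality_assoc, he, ← Functor.map_comp_assoc, he]
    -- What remains is that `μ` at `F a` equals `T (η⁻¹)`, which follows from the unit law `T η ≫ μ
    -- = 𝟙`.
    congr 1
    rw [Functor.map_inv]
    exact IsIso.eq_inv_of_hom_inv_id (T.right_unit _)
  exact ⟨MonadIso.mk e (fun X => congr_app hη X) (fun X => congr_app hμ X)⟩

end Codensity

/-! ### Continuous maps between powers of the Sierpinski space -/

theorem FreeFrame.lift_iff {X : Type u} (p : X → Prop) (U : FreeFrame X) :
    FreeFrame.lift p U ↔ ∃ F : Finset X, toDual F ∈ U ∧ ∀ x ∈ F, p x := by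
  have h (F : Finset X) : F.inf p ↔ ∀ x ∈ F, p x := by
    classical
    induction F using Finset.induction_on with
    | empty => simp
    | insert a s _ ih =>
      rw [Finset.inf_insert, Finset.forall_mem_insert, ← ih]
      rfl
  change (⨆ (F : Finset X) (_ : toDual F ∈ U), F.inf p) ↔ _
  simp [h]

/-- Since `U` is upwards closed, it is recovered from its values at indicators of finite sets. -/
theorem FreeFrame.lift_mem_iff {X : Type u} (G : Finset X) (U : FreeFrame X) :
    FreeFrame.lift (fun x => x ∈ G) U ↔ toDual G ∈ U := by
  rw [FreeFrame.lift_iff]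
  exact ⟨fun ⟨F, hF, h⟩ => U.lower (toDual_le_toDual.2 h) hF, fun h => ⟨G, h, fun _ => id⟩⟩

theorem FreeFrame.lift_apply_injective {X : Type u} {U V : FreeFrame X}
    (h : ∀ p : X → Prop, FreeFrame.lift p U ↔ FreeFrame.lift p V) : U = V := by
  ext F
  exact (FreeFrame.lift_mem_iff (ofDual F) U).symm.trans
    ((h _).trans (FreeFrame.lift_mem_iff (ofDual F) V))

/-- The only neighbourhood of false is the whole space, so false coordinates of a point put no
constraint on its basic neighbourhoods. -/
theorem eq_univ_of_isOpen_of_not {s : Set Prop} (hs : IsOpen s) {q : Prop} (hq : q ∈ s)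
    (h : ¬ q) (r : Prop) : r ∈ s := by
  have hs' := hs.mem_nhds hq
  rw [eq_false h, nhds_false, Filter.mem_top] at hs'
  exact hs' ▸ Set.mem_univ r

/-- A continuous map from a power of the Sierpinski space is determined by its values on finite
sets. -/
theorem sierpinskiPower_apply_iff {X : Type u} (f : C(X → Prop, Prop)) (p : X → Prop) :
    f p ↔ ∃ F : Finset X, f (fun x => x ∈ F) ∧ ∀ x ∈ F, p x := by
  classical
  have key (p : X → Prop) (hp : f p) : ∃ F : Finset X, (∀ x ∈ F, p x) ∧
      ∀ q : X → Prop, (∀ x ∈ F, q x) → f q := by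
    obtain ⟨I, u, hu, hI⟩ := isOpen_pi_iff.1 (continuous_Prop.1 f.continuous) p hp
    -- Among the finitely many constrained coordinates, only those where `p` is true count.
    refine ⟨I.filter p, fun x hx => (Finset.mem_filter.1 hx).2, fun q hq => hI fun x hx => ?_⟩
    by_cases hpx : p x
    · have : q x = p x := by simp [hpx, hq x (Finset.mem_filter.2 ⟨hx, hpx⟩)]
      rw [this]
      exact (hu x hx).2
    · exact eq_univ_of_isOpen_of_not (hu x hx).1 (hu x hx).2 hpx _
  constructor
  · intro hp
    obtain ⟨F, hF, h⟩ := key p hp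
    exact ⟨F, h _ fun _ => id, hF⟩
  · rintro ⟨F, hF, h⟩
    obtain ⟨G, hG, h'⟩ := key _ hF
    exact h' p fun x hx => h x (hG x hx)

/-- The witness `U` consists of the finite sets whose indicator satisfies `f`; it is upwards closed
because `f` is monotone. -/
theorem exists_lift_eq {X : Type u} (f : C(X → Prop, Prop)) :
    ∃ U : FreeFrame X, ∀ p, f p = FreeFrame.lift p U := by
  refine ⟨⟨{F | f fun x => x ∈ ofDual F}, fun F _ hFG hF => ?_⟩, fun p => propext ?_⟩
  · exact (sierpinskiPower_apply_iff f _).2 ⟨ofDual F, hF, fun x hx => hFG hx⟩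
  · rw [sierpinskiPower_apply_iff, FreeFrame.lift_iff]
    rfl

theorem sierpinskiPower_isEquivalence : sierpinskiPower.{u}.IsEquivalence where
  faithful :=
    ⟨fun {X Y} f g hfg => by
      apply Quiver.Hom.unop_inj
      ext x
      apply FreeFrame.lift_apply_injective
      intro p
      have := congrArg (fun k => (k.hom.hom : (X.unop.of → Prop) → Y.unop.of → Prop) p x) hfg
      exact iff_of_eq this⟩
  full :=
    ⟨fun {X Y} g => by
      let k : C(X.unop.of → Prop, Y.unop.of → Prop) := g.hom.hom
      choose U hU using fun y : Y.unop.of =>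
        exists_lift_eq ((ContinuousMap.mk (fun q : Y.unop.of → Prop => q y)
          (continuous_apply y)).comp k)
      refine ⟨Quiver.Hom.op ⟨TypeCat.ofHom U⟩, ?_⟩
      ext p
      exact funext fun y => (hU y p).symm⟩
  essSurj :=
    ⟨fun ⟨S, hS⟩ => by
      obtain ⟨X⟩ := hS
      exact ⟨Opposite.op (Kleisli.mk _ X), ⟨Iso.refl _⟩⟩⟩

/-- Restriction to generators is a homeomorphism from the space of points of the free frame on `X`
to the power `𝕊 ^ X`. -/
def freeFramePoints (X : Type u) : (X → Prop) ≃ₜ FrameHom (FreeFrame X) Prop where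
  toFun := FreeFrame.lift
  invFun h x := h (FreeFrame.gen x)
  left_inv p := funext fun x => FreeFrame.lift_gen p x
  right_inv _ := FreeFrame.hom_ext fun x => FreeFrame.lift_gen _ x
  continuous_toFun := framePoints_continuous_iff.2 continuous_lift_apply
  continuous_invFun := continuous_pi fun _ => framePoints_continuous_eval _ _

/-- The homeomorphisms between the powers of the Sierpinski space and the spaces of points of free
frames are natural. -/
def sierpinskiPowerIso :
    sierpinskiPower.{u} ⋙ sierInclusion.{u} ≅ kleisliToFrm.{u}.op ⋙ framePoints.{u} :=
  NatIso.ofComponents (fun X => TopCat.isoOfHomeo (freeFramePoints X.unop.of))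
    fun {X Y} f => by
      ext (p : X.unop.of → Prop)
      exact (FreeFrame.hom_lift (FreeFrame.lift p) (kleisliFun f.unop)).symm

/-! ### Sobrification as a right Kan extension -/

/-- `f` is a join of finite meets of projections, and `φ` preserves these operations. -/
theorem frameHom_apply_sierpinskiPower {Y : Type u}
    (φ : FrameHom C(Y → Prop, Prop) Prop) (f : C(Y → Prop, Prop)) :
    φ f = f fun y => φ ⟨fun p => p y, continuous_apply y⟩ := by
  obtain ⟨U, hU⟩ := exists_lift_eq f
  let ev (y : Y) : C(Y → Prop, Prop) := ⟨fun p => p y, continuous_apply y⟩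
  have hf : f = FreeFrame.lift ev U := ContinuousMap.ext fun p =>
    (hU p).trans (DFunLike.congr_fun (FreeFrame.hom_lift (sierpinskiEval p) ev) U).symm
  rw [hU]
  exact (congrArg φ hf).trans (DFunLike.congr_fun (FreeFrame.hom_lift φ ev) U)

/-- Powers of the Sierpinski space are sober: every point of the frame of continuous maps
`𝕊 ^ Y → 𝕊` is the evaluation at a unique point of `𝕊 ^ Y`. -/
def sierpinskiPowerEval (Y : Type u) : (Y → Prop) ≃ₜ FrameHom C(Y → Prop, Prop) Prop where
  toFun := sierpinskiEval
  invFun φ y := φ ⟨fun p => p y, continuous_apply y⟩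
  left_inv _ := rfl
  right_inv φ := FrameHom.ext fun f => (frameHom_apply_sierpinskiPower φ f).symm
  continuous_toFun := framePoints_continuous_iff.2 fun f => f.continuous
  continuous_invFun := continuous_pi fun _ => framePoints_continuous_eval _ _

instance isIso_sobrification_unit (S : Sier.{u}) :
    IsIso (sobrificationMonad.{u}.η.app (sierInclusion.obj S)) := by
  obtain ⟨S, ⟨Y⟩⟩ := S
  exact (TopCat.isoOfHomeo (X := TopCat.of (Y → Prop))
    (Y := TopCat.of (FrameHom C(Y → Prop, Prop) Prop)) (sierpinskiPowerEval Y)).isIso_hom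

/-! ### Cones over the maps from a space to powers of `𝕊` -/

section Limit

variable {X : TopCat.{u}}
  (s : Limits.Cone (StructuredArrow.proj X sierInclusion.{u} ⋙ sierInclusion))

/-- The component of a cone at a continuous map to a power of the Sierpinski space. -/
def powerLeg {Y : Type u} (f : C(X, Y → Prop)) : C(s.pt, Y → Prop) :=
  (s.π.app (StructuredArrow.mk (S := X) (Y := (⟨TopCat.of (Y → Prop), ⟨Y⟩⟩ : Sier.{u}))
    (TopCat.ofHom f))).hom

/-- Fullness of `Sier` makes every continuous `h` a morphism of the indexing category. -/
theorem powerLeg_comp {Y Z : Type u} (h : C(Y → Prop, Z → Prop)) (f : C(X, Y → Prop))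
    (t : s.pt) : powerLeg s (h.comp f) t = h (powerLeg s f t) := by
  let P (Y : Type u) : Sier.{u} := ⟨TopCat.of (Y → Prop), ⟨Y⟩⟩
  let a : StructuredArrow X sierInclusion.{u} := .mk (Y := P Y) (TopCat.ofHom f)
  let b : StructuredArrow X sierInclusion.{u} := .mk (Y := P Z) (TopCat.ofHom (h.comp f))
  let k : a ⟶ b := StructuredArrow.homMk (ObjectProperty.homMk (TopCat.ofHom h)) rfl
  exact (ConcreteCategory.congr_hom (s.w k) t).symm

/-- The component of a cone at a continuous map to the Sierpinski space. -/
def sierpinskiLeg (f : C(X, Prop)) : C(s.pt, Prop) :=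
  ⟨fun t => powerLeg s (ContinuousMap.pi fun _ : PUnit.{u + 1} => f) t PUnit.unit,
    (continuous_apply _).comp (powerLeg s _).continuous⟩

theorem powerLeg_apply {Y : Type u} (f : C(X, Y → Prop)) (t : s.pt) (y : Y) :
    powerLeg s f t y = sierpinskiLeg s ((ContinuousMap.eval y).comp f) t :=
  (congrFun (powerLeg_comp s
    (ContinuousMap.pi fun _ : PUnit.{u + 1} => ContinuousMap.eval y) f t) PUnit.unit).symm

theorem sierpinskiLeg_comp {Y : Type u} (h : C(Y → Prop, Prop)) (f : C(X, Y → Prop)) (t : s.pt) :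
    sierpinskiLeg s (h.comp f) t = h (powerLeg s f t) :=
  congrFun (powerLeg_comp s (ContinuousMap.pi fun _ : PUnit.{u + 1} => h) f t) PUnit.unit

/-- A point of the vertex of a cone induces a point of the frame of continuous maps to the
Sierpinski space, since the frame operations are continuous maps between powers of the Sierpinski
space. -/
def legPoint (t : s.pt) : FrameHom C(X, Prop) Prop where
  toFun f := sierpinskiLeg s f t
  map_inf' f g := by
    -- Binary meet is the continuous map `𝕊 ^ 2 → 𝕊` given by the meet of the two projections.
    let k : C(X, ULift.{u} Bool → Prop) := ContinuousMap.pi fun b => bif b.down then f else g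
    have h := sierpinskiLeg_comp s (ContinuousMap.eval ⟨true⟩ ⊓ ContinuousMap.eval ⟨false⟩) k t
    refine h.trans ?_
    change (powerLeg s k t ⟨true⟩ ∧ powerLeg s k t ⟨false⟩) = _
    rw [powerLeg_apply, powerLeg_apply]
    rfl
  map_top' := sierpinskiLeg_comp s (Y := PEmpty) ⊤ (ContinuousMap.pi fun _ => ⊤) t
  map_sSup' S := by
    -- The join of `S` is an operation of arity `S`: the join of all projections on `𝕊 ^ S`.
    let k : C(X, S → Prop) := ContinuousMap.pi fun f => f.1
    have hk : sSup S = (sSup (Set.range ContinuousMap.eval)).comp k := by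
      ext x
      rw [ContinuousMap.comp_apply, sierpinski_sSup_apply, sierpinski_sSup_apply]
      simp [k]
    apply propext
    rw [hk, sierpinskiLeg_comp, sierpinski_sSup_apply, sSup_Prop_eq]
    simp only [Set.exists_range_iff, Set.exists_mem_image, Subtype.exists]
    refine exists_congr fun f => ?_
    rw [← exists_prop]
    exact exists_congr fun hf => iff_of_eq (powerLeg_apply s k t ⟨f, hf⟩)

/-- The comparison map from the vertex of a cone to the sobrification. -/
noncomputable def legPoints : s.pt ⟶ sobrificationMonad.obj X :=
  TopCat.ofHom ⟨legPoint s, framePoints_continuous_iff.2 fun f => (sierpinskiLeg s f).continuous⟩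

theorem legPoints_comp_map (a : StructuredArrow X sierInclusion.{u}) :
    legPoints s ≫ sobrificationMonad.map a.hom =
      s.π.app a ≫ sobrificationMonad.η.app (sierInclusion.obj a.right) := by
  obtain ⟨⟨⟩, ⟨S, ⟨Y⟩⟩, f⟩ := a
  ext t
  exact FrameHom.ext fun g : C(Y → Prop, Prop) => sierpinskiLeg_comp s g f.hom t

end Limit

/-- The sobrification is a pointwise right Kan extension of the inclusion of `Sier` along
itself. -/
noncomputable def sobrificationIsPointwiseRightKanExtension :
    (unitInvExtension sierInclusion.{u} sobrificationMonad).IsPointwiseRightKanExtension :=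
  fun X =>
    { lift s := legPoints s
      fac s a := (comp_unitInvExtension_coneAt_π_eq_iff _ _ a _ _).2 (legPoints_comp_map s a)
      uniq s m hm := by
        ext t
        refine FrameHom.ext fun f : C(X, Prop) => ?_
        -- The leg at `f`, viewed as a map to `𝕊 ^ 1`, already determines the value of `m t` at `f`.
        let a : StructuredArrow X sierInclusion.{u} :=
          .mk (Y := (⟨TopCat.of (PUnit.{u + 1} → Prop), ⟨PUnit⟩⟩ : Sier.{u}))
            (TopCat.ofHom (ContinuousMap.pi fun _ => f))
        have h : m ≫ sobrificationMonad.map a.hom =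
            s.π.app a ≫ sobrificationMonad.η.app (sierInclusion.obj a.right) :=
          (comp_unitInvExtension_coneAt_π_eq_iff _ _ a _ _).1 (hm a)
        exact DFunLike.congr_fun (F := FrameHom C(PUnit.{u + 1} → Prop, Prop) Prop)
          (ConcreteCategory.congr_hom h t) (ContinuousMap.eval PUnit.unit) }

theorem mainTheorem11 :
    sierpinskiPower.{u}.IsEquivalence ∧
    (∃ α : sierpinskiPower.{u} ⋙ sierInclusion.{u} ≅ kleisliToFrm.{u}.op ⋙ framePoints.{u},
      ∀ (X : Type u) (h : FrameHom (FreeFrame X) Prop) (x : X),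
        (α.inv.app (Opposite.op (Kleisli.mk freeFrameMonad X)) h : X → Prop) x =
          h (FreeFrame.gen x)) ∧
    (∃ _ : sierInclusion.{u}.HasPointwiseRightKanExtension sierInclusion.{u},
      Nonempty (sobrificationMonad.{u} ≅ codensityMonad sierInclusion.{u})) := by
  let h := sobrificationIsPointwiseRightKanExtension.{u}
  exact ⟨sierpinskiPower_isEquivalence, ⟨sierpinskiPowerIso, fun _ _ _ => rfl⟩,
    h.hasPointwiseRightKanExtension,
    haveI := h.hasPointwiseRightKanExtension
    nonempty_iso_codensityMonad _ _ h.isRightKanExtension⟩
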